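/- There is a universal constant $C>0$ such that the following holds. Let $Y_1,\dots,Y_N$ be i.i.d. random elements of a measurable space $\mathcal X$ (for instance $\mathbb R^d$), and let $X_1,\dots,X_N$ be a corrupted version of this sample: there is a (possibly random) set $\mathcal O\subset\{1,\dots,N\}$ such that, almost surely, $X_i=Y_i$ for all $i\notin\mathcal O$; nothing is assumed on $(X_i)_{i\in\mathcal O}$ or on the dependence of $\mathcal O$ and $(X_i)_{i\in\mathcal O}$ on the sample and the blocks. Let $B_1,\dots,B_K\subset\{1,\dots,N\}$, $K\ge 1$, be disjoint blocks of the same size $m$, deterministic or chosen at random independently of $(Y_1,\dots,Y_N)$, and put $\mathbf X_k=(X_i)_{i\in B_k}\in\mathcal X^m$ and $\mathbf Y_k=(Y_i)_{i\in B_k}\in\mathcal X^m$. Let $\mathcal F$ be a set of measurable functions $\mathcal X^m\to\{0,1\}$. A finite set $S\subset\mathcal X^m$ is shattered by $\mathcal F$ if for every $A\subset S$ there is $f\in\mathcal F$ with $S\cap f^{-1}(\{1\})=A$, and $\mathrm{VC}(\mathcal F)$ denotes the largest cardinality of a finite set shattered by $\mathcal F$ ($+\infty$ if there is no largest one, $0$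 if $\mathcal F=\emptyset$). Suppose that $\mathcal F$ is a $P$-measurable class for the law $P$ of $\mathbf Y_1$, that is, for all $n$ and all $e\in\mathbb R^n$ the function $(z_1,\dots,z_n)\mapsto\sup_{f\in\mathcal F}\bigl|\sum_{i=1}^n e_i f(z_i)\bigr|$ is measurable for the completion of $P^{\otimes n}$ (this is automatic if $\mathcal F$ is countable). Assume that - $\mathbb P(f(\mathbf Y_1)=0)\ge 15/16$ for all $f\in\mathcal F$; - almost surely, $K\ge C\,(\mathrm{VC}(\mathcal F)\vee|\mathcal O|)$. Then, with probability at least $1-\exp(-K/128)$ (that is, on some measurable event of at least this probability), for every $f\in\mathcal F$ there are at least $3K/4$ indices $k\in\{1,\dots,K\}$ with $f(\mathbf X_k)=0$. -/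

import Mathlib

open MeasureTheory ProbabilityTheory

/-- A finite set `S` is shattered by a class `F` of Boolean functions if every subset `B` of `S`
is of the form `S ∩ f ⁻¹ {1}` for some `f ∈ F`. -/
def ShatteredBy {Z : Type*} (F : Set (Z → Bool)) (S : Finset Z) : Prop :=
  ∀ B : Finset Z, B ⊆ S → ∃ f ∈ F, (S : Set Z) ∩ f ⁻¹' {true} = (B : Set Z)

/-- The VC-dimension of a class of Boolean functions: the largest cardinality of a finite set
that the class shatters (`⊤` if there are shattered sets of arbitrarily large size). -/
noncomputable def vcDimension {Z : Type*} (F : Set (Z → Bool)) : ℕ∞ :=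
  ⨆ (S : Finset Z) (_ : ShatteredBy F S), (S.card : ℕ∞)

/-- `F` is a `P`-measurable class: for all `n` and all real `e_1, …, e_n`, the function
`(z_1, …, z_n) ↦ sup_{f ∈ F} |∑ i, e_i f(z_i)|` is measurable for the completion of `P ^ n`.
The supremum is that of a set bounded by `∑ i, |e_i|`. -/
def IsMeasurableClass {Z : Type*} [MeasurableSpace Z] (P : Measure Z) (F : Set (Z → Bool)) :
    Prop :=
  ∀ (n : ℕ) (e : Fin n → ℝ),
    AEMeasurable (fun z : Fin n → Z => ⨆ f : F, |∑ i, e i * (if f.1 (z i) = true then 1 else 0)|)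
      (Measure.pi fun _ => P)

/-- The `k`-th block `(x_i)_{i ∈ B_k}` of a data set `x_1, …, x_N`, where the block `B_k` consists
of the `m` indices `B k 0, …, B k (m - 1)`. -/
def dataBlock {α : Type*} {N K m : ℕ} (B : Fin K → Fin m → Fin N) (x : Fin N → α) (k : Fin K) :
    Fin m → α :=
  fun j => x (B k j)

/-! Conditionally on the blocks, the clean block data are i.i.d. with a law that does not depend on
the blocks, so they are i.i.d. unconditionally (`map_dataBlock_eq_pi`). It then suffices that,
except with probability `exp (-K / 128)`, every `f` equals 1 on at most `(1/4 - 2⁻¹⁷) K` clean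
blocks: disjointness lets each outlier spoil at most one block, and there are at most `2⁻¹⁷ K`
outliers (`card_false_ge`).

This uniform bound is the Vapnik–Chervonenkis argument. A ghost sample replaces the deviation by a
difference of two empirical sums (`measure_exists_sum_gt_le`). Exchanging the two copies of a point
preserves the law, so random signs may be inserted. For a fixed double sample only its trace
matters, so Hoeffding's inequality and a union bound suffice (`card_signSwap_le`), with Sauer–Shelah
controlling the size of the trace (`card_traceFamily_le`). -/

/-! ### Rademacher sums -/

theorem sum_exp_sign_le {ι : Type*} [Fintype ι] [DecidableEq ι] (a : ι → ℝ)
    (ha : ∀ k, |a k| ≤ 1) (l : ℝ) :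
    ∑ ε : ι → Bool, Real.exp (l * ∑ k, (if ε k then 1 else -1) * a k) ≤
      2 ^ Fintype.card ι * Real.exp (Fintype.card ι * (l ^ 2 / 2)) := by
  have h1 : ∀ ε : ι → Bool, Real.exp (l * ∑ k, (if ε k then 1 else -1) * a k) =
      ∏ k, Real.exp (l * ((if ε k then 1 else -1) * a k)) := by
    intro ε
    rw [Finset.mul_sum, Real.exp_sum]
  have h2 : ∑ ε : ι → Bool, ∏ k, Real.exp (l * ((if ε k then 1 else -1) * a k)) =
      ∏ k, ∑ b : Bool, Real.exp (l * ((if b then 1 else -1) * a k)) := by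
    rw [Finset.prod_univ_sum, Fintype.piFinset_univ]
  have h3 : ∀ k, ∑ b : Bool, Real.exp (l * ((if b then 1 else -1) * a k)) ≤
      2 * Real.exp (l ^ 2 / 2) := by
    intro k
    have e : ∑ b : Bool, Real.exp (l * ((if b then 1 else -1) * a k)) =
        2 * Real.cosh (l * a k) := by
      rw [Real.cosh_eq]; simp; ring
    rw [e]
    have h4 : (l * a k) ^ 2 ≤ l ^ 2 := by
      rw [mul_pow]
      have : (a k) ^ 2 ≤ 1 := by rw [← sq_abs]; exact pow_le_one₀ (abs_nonneg _) (ha k)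
      nlinarith [sq_nonneg l]
    have := Real.cosh_le_exp_half_sq (l * a k)
    have h5 : Real.exp ((l * a k) ^ 2 / 2) ≤ Real.exp (l ^ 2 / 2) :=
      Real.exp_le_exp.2 (by linarith)
    linarith
  rw [Finset.sum_congr rfl fun ε _ => h1 ε, h2]
  calc _ ≤ ∏ _k : ι, 2 * Real.exp (l ^ 2 / 2) :=
        Finset.prod_le_prod (fun k _ => Finset.sum_nonneg fun _ _ => (Real.exp_pos _).le)
          fun k _ => h3 k
    _ = _ := by rw [Finset.prod_const, mul_pow, ← Real.exp_nat_mul]; simp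

/-- Hoeffding's inequality for Rademacher sums, in counting form. -/
theorem card_sign_le {ι : Type*} [Fintype ι] [DecidableEq ι] (a : ι → ℝ)
    (ha : ∀ k, |a k| ≤ 1) {s : ℝ} (hs : 0 ≤ s) :
    ((Finset.univ.filter fun ε : ι → Bool =>
        s * Fintype.card ι < |∑ k, (if ε k then 1 else -1) * a k|).card : ℝ) ≤
      2 ^ Fintype.card ι * (2 * Real.exp (-(Fintype.card ι * (s ^ 2 / 2)))) := by
  set n := (Fintype.card ι : ℝ)
  set S : (ι → Bool) → ℝ := fun ε => ∑ k, (if ε k then 1 else -1) * a k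
  -- Chernoff with the optimal exponents `s` and `-s`, one for each sign of the sum.
  have key : ∀ ε ∈ (Finset.univ.filter fun ε : ι → Bool => s * n < |S ε|),
      Real.exp (n * s ^ 2) ≤ Real.exp (s * S ε) + Real.exp (-s * S ε) := by
    intro ε hε
    have h : s * n < |S ε| := (Finset.mem_filter.1 hε).2
    rcases lt_abs.1 h with h | h
    · have : Real.exp (n * s ^ 2) ≤ Real.exp (s * S ε) := Real.exp_le_exp.2 (by nlinarith)
      linarith [Real.exp_pos (-s * S ε)]
    · have : Real.exp (n * s ^ 2) ≤ Real.exp (-s * S ε) := Real.exp_le_exp.2 (by nlinarith)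
      linarith [Real.exp_pos (s * S ε)]
  have h1 := Finset.card_nsmul_le_sum _ _ _ key
  have h2 : ∑ ε ∈ (Finset.univ.filter fun ε : ι → Bool => s * n < |S ε|),
      (Real.exp (s * S ε) + Real.exp (-s * S ε)) ≤
      ∑ ε, (Real.exp (s * S ε) + Real.exp (-s * S ε)) :=
    Finset.sum_le_sum_of_subset_of_nonneg (Finset.filter_subset _ _)
      fun _ _ _ => by positivity
  have h3 := sum_exp_sign_le a ha s
  have h4 := sum_exp_sign_le a ha (-s)
  rw [neg_sq] at h4
  rw [nsmul_eq_mul] at h1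
  replace h1 := h1.trans h2
  rw [Finset.sum_add_distrib] at h1
  have h5 : Real.exp (-(n * (s ^ 2 / 2))) * Real.exp (n * s ^ 2) = Real.exp (n * (s ^ 2 / 2)) := by
    rw [← Real.exp_add]; ring_nf
  refine le_of_mul_le_mul_right ?_ (Real.exp_pos (n * s ^ 2))
  rw [mul_assoc, mul_assoc, h5]
  linarith

/-! ### Binomial sums, traces and VC dimension -/

/-- Since `x ≤ 1`, weighting by `x ^ k` instead of `x ^ d` only increases the sum for `k ≤ d`; the
binomial theorem and `1 + x ≤ exp x` finish. A small `x` makes the exponential rate in `n` as small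
as needed. -/
theorem sum_choose_le {n d : ℕ} {x : ℝ} (hx : 0 < x) (hx1 : x ≤ 1) :
    (∑ k ∈ Finset.Iic d, (n.choose k : ℝ)) ≤ Real.exp (x * n) * (x⁻¹) ^ d := by
  have h1 : (∑ k ∈ Finset.Iic d, (n.choose k : ℝ)) * x ^ d ≤ Real.exp (x * n) := by
    calc _ = ∑ k ∈ Finset.Iic d, (n.choose k : ℝ) * x ^ d := Finset.sum_mul _ _ _
      _ ≤ ∑ k ∈ Finset.Iic d, (n.choose k : ℝ) * x ^ k := by
          refine Finset.sum_le_sum fun k hk => ?_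
          have := pow_le_pow_of_le_one hx.le hx1 (Finset.mem_Iic.1 hk)
          gcongr
      _ ≤ ∑ k ∈ Finset.range (max n d + 1), (n.choose k : ℝ) * x ^ k := by
          refine Finset.sum_le_sum_of_subset_of_nonneg ?_ fun _ _ _ => by positivity
          intro k hk
          have := Finset.mem_Iic.1 hk
          simp; omega
      _ = ∑ k ∈ Finset.range (n + 1), (n.choose k : ℝ) * x ^ k := by
          symm
          refine Finset.sum_subset ?_ ?_
          · intro k hk; simp at hk ⊢; omega
          · intro k _ hk
            simp at hk
            rw [Nat.choose_eq_zero_of_lt (by omega)]; simp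
      _ = (x + 1) ^ n := by
          rw [add_pow]; refine Finset.sum_congr rfl fun k _ => by simp [mul_comm]
      _ ≤ (Real.exp x) ^ n := by
          gcongr; exact Real.add_one_le_exp x
      _ = Real.exp (x * n) := by rw [← Real.exp_nat_mul, mul_comm]
  rw [inv_pow, ← div_eq_mul_inv, le_div_iff₀ (by positivity)]
  exact h1

open Classical in
/-- The family of the subsets of the index set that `F` picks out at the points `z i`. -/
noncomputable def traceFamily {Z ι : Type*} [Fintype ι] (F : Set (Z → Bool)) (z : ι → Z) :
    Finset (Finset ι) :=
  Finset.univ.filter fun T => ∃ f ∈ F, ∀ i, i ∈ T ↔ f (z i) = true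

theorem mem_traceFamily {Z ι : Type*} [Fintype ι] {F : Set (Z → Bool)} {z : ι → Z}
    {T : Finset ι} : T ∈ traceFamily F z ↔ ∃ f ∈ F, ∀ i, i ∈ T ↔ f (z i) = true := by
  simp [traceFamily]

/-- Transfers shattering from indices to points, where the `z i` may repeat: two indices with the
same point cannot be separated, so a shattered index set carries distinct points and no cardinality
is lost. -/
theorem shatteredBy_image_of_shatters {Z ι : Type*} [Fintype ι] [DecidableEq ι] [DecidableEq Z]
    {F : Set (Z → Bool)} {z : ι → Z} {S : Finset ι} (h : (traceFamily F z).Shatters S) :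
    Set.InjOn z S ∧ ShatteredBy F (S.image z) := by
  have key : ∀ T ⊆ S, ∃ f ∈ F, ∀ i ∈ S, i ∈ T ↔ f (z i) = true := by
    intro T hT
    obtain ⟨U, hU, hUT⟩ := h hT
    obtain ⟨f, hf, hfU⟩ := mem_traceFamily.1 hU
    refine ⟨f, hf, fun i hi => ?_⟩
    rw [← hfU, ← hUT]; simp [hi]
  constructor
  · intro i hi j hj hij
    by_contra hne
    obtain ⟨f, -, hf⟩ := key {i} (by simpa using hi)
    have h1 := (hf i hi).1 (by simp)
    rw [hij] at h1
    exact hne ((Finset.mem_singleton.1 ((hf j hj).2 h1)).symm)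
  · intro B hB
    obtain ⟨f, hf, hfT⟩ := key (S.filter fun i => z i ∈ B) (Finset.filter_subset _ _)
    refine ⟨f, hf, ?_⟩
    ext y
    simp only [Finset.coe_image, Set.mem_inter_iff, Set.mem_image, Finset.mem_coe,
      Set.mem_preimage, Set.mem_singleton_iff]
    constructor
    · rintro ⟨⟨i, hi, rfl⟩, hy⟩
      simpa [hi] using (hfT i hi).2 hy
    · intro hy
      obtain ⟨i, hi, rfl⟩ := Finset.mem_image.1 (hB hy)
      exact ⟨⟨i, hi, rfl⟩, (hfT i hi).1 (by simp [hi, hy])⟩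

theorem card_le_of_shatteredBy {Z : Type*} {F : Set (Z → Bool)} {d : ℕ}
    (hF : vcDimension F ≤ d) {S : Finset Z} (h : ShatteredBy F S) : S.card ≤ d := by
  have : (S.card : ℕ∞) ≤ vcDimension F :=
    le_iSup₂ (f := fun (S : Finset Z) (_ : ShatteredBy F S) => (S.card : ℕ∞)) S h
  exact_mod_cast this.trans hF

/-- The Sauer-Shelah bound for the trace of a class on finitely many points. -/
theorem card_traceFamily_le {Z ι : Type*} [Fintype ι] {F : Set (Z → Bool)} {d : ℕ}
    (hF : vcDimension F ≤ d) (z : ι → Z) :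
    (traceFamily F z).card ≤ ∑ k ∈ Finset.Iic d, (Fintype.card ι).choose k := by
  classical
  refine (Finset.card_le_card_shatterer _).trans
    (Finset.card_shatterer_le_sum_vcDim.trans ?_)
  refine Finset.sum_le_sum_of_subset (Finset.Iic_subset_Iic.2 ?_)
  refine Finset.sup_le fun S hS => ?_
  obtain ⟨h1, h2⟩ := shatteredBy_image_of_shatters (Finset.mem_shatterer.1 hS)
  rw [← Finset.card_image_of_injOn h1]
  exact card_le_of_shatteredBy hF h2

/-- A point at which two members of the class differ would be a shattered singleton. -/
theorem subsingleton_of_vcDimension_le_zero {Z : Type*} {F : Set (Z → Bool)}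
    (hF : vcDimension F ≤ (0 : ℕ)) : F.Subsingleton := by
  classical
  have key : ∀ f ∈ F, ∀ g ∈ F, ∀ z, f z = true → g z = true := by
    intro f hf g hg z hfz
    by_contra hgz
    have : ShatteredBy F {z} := by
      intro B hB
      rcases Finset.subset_singleton_iff.1 hB with rfl | rfl
      · exact ⟨g, hg, by ext y; simp only [Finset.coe_singleton, Finset.coe_empty]; aesop⟩
      · exact ⟨f, hf, by ext y; simp only [Finset.coe_singleton]; aesop⟩
    simpa using card_le_of_shatteredBy hF this
  intro f hf g hg
  funext z
  exact Bool.eq_iff_iff.2 ⟨key f hf g hg z, key g hg f hf z⟩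

/-! ### Suprema over the class and their measurability -/

/-- The supremum over the class of the absolute weighted sums `∑ i, e i * f (w i)`. -/
noncomputable def supWeightedSum {Z ι : Type*} [Fintype ι] (F : Set (Z → Bool)) (e : ι → ℝ)
    (w : ι → Z) : ℝ :=
  ⨆ f : F, |∑ i, e i * (if f.1 (w i) = true then 1 else 0)|

theorem bddAbove_weightedSum {Z ι : Type*} [Fintype ι] (F : Set (Z → Bool)) (e : ι → ℝ)
    (w : ι → Z) :
    BddAbove (Set.range fun f : F => |∑ i, e i * (if f.1 (w i) = true then (1 : ℝ) else 0)|) := by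
  refine ⟨∑ i, |e i|, ?_⟩
  rintro _ ⟨f, rfl⟩
  refine (Finset.abs_sum_le_sum_abs _ _).trans (Finset.sum_le_sum fun i _ => ?_)
  split_ifs <;> simp

theorem lt_supWeightedSum_iff {Z ι : Type*} [Fintype ι] {F : Set (Z → Bool)} {e : ι → ℝ}
    {w : ι → Z} {c : ℝ} (hc : 0 ≤ c) :
    c < supWeightedSum F e w ↔
      ∃ f ∈ F, c < |∑ i, e i * (if f (w i) = true then (1 : ℝ) else 0)| := by
  constructor
  · intro h
    -- The real supremum over an empty class is 0 by default, hence the need for `0 ≤ c`.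
    rcases isEmpty_or_nonempty F with hF | hF
    · rw [supWeightedSum, Real.iSup_of_isEmpty] at h
      exact absurd h hc.not_gt
    · obtain ⟨f, hf⟩ := exists_lt_of_lt_ciSup h
      exact ⟨f.1, f.2, hf⟩
  · rintro ⟨f, hf, h⟩
    exact h.trans_le (le_ciSup (bddAbove_weightedSum F e w) ⟨f, hf⟩)

theorem measurePreserving_comp_equiv {Z ι ι' : Type*} [MeasurableSpace Z] [Fintype ι]
    [Fintype ι'] (P : Measure Z) [SigmaFinite P] (e : ι ≃ ι') :
    MeasurePreserving (fun w : ι' → Z => fun i => w (e i)) (Measure.pi fun _ => P)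
      (Measure.pi fun _ => P) := by
  have h := measurePreserving_piCongrLeft (fun _ : ι => P) e.symm
  convert h using 1
  funext w i
  rw [MeasurableEquiv.coe_piCongrLeft]
  obtain ⟨j, rfl⟩ := e.symm.surjective i
  rw [Equiv.piCongrLeft_apply_apply, e.apply_symm_apply]

theorem IsMeasurableClass.aemeasurable {Z ι : Type*} [MeasurableSpace Z] [Fintype ι]
    {P : Measure Z} [SigmaFinite P] {F : Set (Z → Bool)} (h : IsMeasurableClass P F)
    (e : ι → ℝ) : AEMeasurable (supWeightedSum F e) (Measure.pi fun _ => P) := by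
  let φ := Fintype.equivFin ι
  have h1 := (h (Fintype.card ι) fun i => e (φ.symm i)).comp_quasiMeasurePreserving
    (measurePreserving_comp_equiv P φ.symm).quasiMeasurePreserving
  convert h1 using 1
  funext w
  unfold supWeightedSum
  simp only [Function.comp_def]
  congr 1
  funext f
  congr 1
  exact (Equiv.sum_comp φ.symm fun i => e i * (if f.1 (w i) = true then (1 : ℝ) else 0)).symm

/-! ### Symmetrisation by random signs -/

/-- The permutation of a double sample that exchanges the two copies of `k` whenever `ε k` is
`false`. -/
def signSwap {ι : Type*} (ε : ι → Bool) : ι ⊕ ι ≃ ι ⊕ ι :=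
  Function.Involutive.toPerm
    (Sum.elim (fun k => if ε k then Sum.inl k else Sum.inr k)
      fun k => if ε k then Sum.inr k else Sum.inl k) <| by
    rintro (k | k) <;> by_cases h : ε k <;> simp [h]

/-- The weights `1` on the first sample and `-1` on the second one. -/
def doubleSign {ι : Type*} : ι ⊕ ι → ℝ := Sum.elim (fun _ => 1) fun _ => -1

/-- Exchanging the copies of `k` flips the sign of their difference, so permuting the double sample
turns the difference of the two sums into a Rademacher sum. -/
theorem sum_doubleSign_signSwap {ι : Type*} [Fintype ι] (ε : ι → Bool) (g : ι ⊕ ι → ℝ) :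
    ∑ i, doubleSign i * g (signSwap ε i) =
      ∑ k, (if ε k then 1 else -1) * (g (Sum.inl k) - g (Sum.inr k)) := by
  rw [Fintype.sum_sum_type, ← Finset.sum_add_distrib]
  refine Finset.sum_congr rfl fun k _ => ?_
  by_cases h : ε k <;>
    simp [doubleSign, signSwap, h, Function.Involutive.toPerm] <;> ring

/-- For each double sample, few choices of the signs make the symmetrised deviation large. -/
theorem card_signSwap_le {Z ι : Type*} [Fintype ι] [DecidableEq ι] {F : Set (Z → Bool)}
    {s : ℝ} (hs : 0 ≤ s) (w : ι ⊕ ι → Z) :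
    ((Finset.univ.filter fun ε : ι → Bool =>
      s * Fintype.card ι < supWeightedSum F doubleSign fun i => w (signSwap ε i)).card : ℝ) ≤
      (traceFamily F w).card *
        (2 ^ Fintype.card ι * (2 * Real.exp (-(Fintype.card ι * (s ^ 2 / 2))))) := by
  classical
  let g : Finset (ι ⊕ ι) → ι ⊕ ι → ℝ := fun T i => if i ∈ T then 1 else 0
  let G : Finset (ι ⊕ ι) → Finset (ι → Bool) := fun T => Finset.univ.filter fun ε =>
    s * Fintype.card ι < |∑ k, (if ε k then 1 else -1) * (g T (Sum.inl k) - g T (Sum.inr k))|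
  -- Union bound: `f` enters only through its trace on `w`, which does not depend on `ε`.
  have hsub : (Finset.univ.filter fun ε : ι → Bool =>
      s * Fintype.card ι < supWeightedSum F doubleSign fun i => w (signSwap ε i)) ⊆
      (traceFamily F w).biUnion G := by
    intro ε hε
    obtain ⟨f, hf, h⟩ := (lt_supWeightedSum_iff (by positivity)).1 (Finset.mem_filter.1 hε).2
    refine Finset.mem_biUnion.2 ⟨Finset.univ.filter fun i => f (w i) = true,
      mem_traceFamily.2 ⟨f, hf, by simp⟩, Finset.mem_filter.2 ⟨Finset.mem_univ _, ?_⟩⟩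
    rw [sum_doubleSign_signSwap ε fun i => if f (w i) = true then (1 : ℝ) else 0] at h
    simpa [g] using h
  have hG : ∀ T ∈ traceFamily F w, ((G T).card : ℝ) ≤
      2 ^ Fintype.card ι * (2 * Real.exp (-(Fintype.card ι * (s ^ 2 / 2)))) := by
    intro T _
    refine card_sign_le _ (fun k => ?_) hs
    simp only [g]
    split_ifs <;> simp
  calc _ ≤ (((traceFamily F w).biUnion G).card : ℝ) := by
        exact_mod_cast Finset.card_le_card hsub
    _ ≤ ∑ T ∈ traceFamily F w, ((G T).card : ℝ) := by
        exact_mod_cast Finset.card_biUnion_le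
    _ ≤ _ := by
        rw [← nsmul_eq_mul]; exact Finset.sum_le_card_nsmul _ _ _ hG

/-- The symmetrised deviation bound: averaging over the sign permutations. -/
theorem measure_supWeightedSum_le {Z ι : Type*} [MeasurableSpace Z] [Fintype ι]
    {P : Measure Z} [IsProbabilityMeasure P] {F : Set (Z → Bool)} (hF : IsMeasurableClass P F)
    {s R : ℝ} (hs : 0 ≤ s) (hR : ∀ w : ι ⊕ ι → Z, ((traceFamily F w).card : ℝ) ≤ R) :
    (Measure.pi fun _ : ι ⊕ ι => P)
        {w | s * Fintype.card ι < supWeightedSum F doubleSign w} ≤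
      ENNReal.ofReal (R * (2 * Real.exp (-(Fintype.card ι * (s ^ 2 / 2))))) := by
  classical
  set Q := Measure.pi fun _ : ι ⊕ ι => P
  set D := {w : ι ⊕ ι → Z | s * Fintype.card ι < supWeightedSum F doubleSign w}
  set c := 2 * Real.exp (-(Fintype.card ι * (s ^ 2 / 2)))
  have hD : NullMeasurableSet D Q :=
    (hF.aemeasurable doubleSign).nullMeasurable measurableSet_Ioi
  let φ : (ι → Bool) → (ι ⊕ ι → Z) → (ι ⊕ ι → Z) := fun ε w i => w (signSwap ε i)
  have hφ : ∀ ε, MeasurePreserving (φ ε) Q Q := fun ε => measurePreserving_comp_equiv P _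
  have h1 : ∀ ε, Q D = ∫⁻ w, (φ ε ⁻¹' D).indicator 1 w ∂Q := by
    intro ε
    rw [lintegral_indicator_one₀ (hD.preimage (hφ ε).quasiMeasurePreserving),
      (hφ ε).measure_preimage hD]
  -- All the permutations preserve `Q`, so this is the mean number of signs that put `w` in `D`;
  -- that number is bounded for each `w` separately.
  have h2 : (2 ^ Fintype.card ι : ENNReal) * Q D =
      ∫⁻ w, ∑ ε, (φ ε ⁻¹' D).indicator 1 w ∂Q := by
    rw [lintegral_finsetSum' _ fun ε _ => AEMeasurable.indicator₀ (f := 1) aemeasurable_const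
      (hD.preimage (hφ ε).quasiMeasurePreserving), ← Finset.sum_congr rfl fun ε _ => h1 ε]
    simp
  have h3 : ∀ w, ∑ ε, (φ ε ⁻¹' D).indicator (1 : (ι ⊕ ι → Z) → ENNReal) w ≤
      ENNReal.ofReal (2 ^ Fintype.card ι * (R * c)) := by
    intro w
    have e : ∑ ε, (φ ε ⁻¹' D).indicator (1 : (ι ⊕ ι → Z) → ENNReal) w =
        ((Finset.univ.filter fun ε : ι → Bool => s * Fintype.card ι <
          supWeightedSum F doubleSign fun i => w (signSwap ε i)).card : ENNReal) := by
      rw [Finset.card_filter, Nat.cast_sum]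
      refine Finset.sum_congr rfl fun ε _ => ?_
      simp only [Set.indicator, Set.mem_preimage, D, Set.mem_ofPred_eq, φ, Pi.one_apply]
      split_ifs <;> simp
    rw [e, ← ENNReal.ofReal_natCast]
    refine ENNReal.ofReal_le_ofReal ((card_signSwap_le hs w).trans ?_)
    have : 0 ≤ c := by positivity
    calc _ ≤ R * (2 ^ Fintype.card ι * c) := by
          gcongr; exact hR w
      _ = _ := by ring
  have h4 : (2 ^ Fintype.card ι : ENNReal) * Q D ≤
      2 ^ Fintype.card ι * ENNReal.ofReal (R * c) := by
    rw [h2]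
    refine (lintegral_mono h3).trans ?_
    rw [lintegral_const, measure_univ, mul_one, ENNReal.ofReal_mul (by positivity),
      ENNReal.ofReal_pow (by norm_num), ENNReal.ofReal_ofNat]
  exact (ENNReal.mul_le_mul_iff_right (by simp) (by simp)).1 h4

/-! ### The ghost sample -/

theorem lintegral_sum_pi {Z ι : Type*} [MeasurableSpace Z] [Fintype ι]
    (P : Measure Z) [IsProbabilityMeasure P] {g : Z → ENNReal} (hg : Measurable g) :
    ∫⁻ z : ι → Z, ∑ k, g (z k) ∂(Measure.pi fun _ => P) = Fintype.card ι * ∫⁻ y, g y ∂P := by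
  rw [lintegral_finsetSum _ fun k _ =>
    show Measurable fun z : ι → Z => g (z k) from hg.comp (measurable_pi_apply k)]
  have : ∀ k : ι, ∫⁻ z : ι → Z, g (z k) ∂(Measure.pi fun _ => P) = ∫⁻ y, g y ∂P := fun k =>
    (measurePreserving_eval (fun _ : ι => P) k).lintegral_comp hg
  simp [this]

/-- Markov's inequality for the ghost sample. -/
theorem third_le_measure_sum_le {Z ι : Type*} [MeasurableSpace Z] [Fintype ι] [Nonempty ι]
    (P : Measure Z) [IsProbabilityMeasure P] {f : Z → Bool} (hf : Measurable f)
    (hP : P {y | f y = true} ≤ ENNReal.ofReal (1 / 16)) :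
    ENNReal.ofReal (1 / 3) ≤ (Measure.pi fun _ : ι => P)
      {z | ∑ k, (if f (z k) = true then (1 : ℝ) else 0) ≤ 3 / 32 * Fintype.card ι} := by
  set Q := Measure.pi fun _ : ι => P
  have hn : (0 : ℝ) < Fintype.card ι := by exact_mod_cast Fintype.card_pos
  have hm : MeasurableSet {y | f y = true} := hf (measurableSet_singleton true)
  let g : Z → ENNReal := {y | f y = true}.indicator 1
  have hg : Measurable g := measurable_one.indicator hm
  have hS : Measurable fun z : ι → Z => ∑ k, g (z k) :=
    Finset.measurable_fun_sum _ fun k _ => hg.comp (measurable_pi_apply k)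
  have e : ∀ z : ι → Z, ∑ k, g (z k) =
      ENNReal.ofReal (∑ k, (if f (z k) = true then (1 : ℝ) else 0)) := by
    intro z
    rw [ENNReal.ofReal_sum_of_nonneg fun k _ => by split_ifs <;> norm_num]
    refine Finset.sum_congr rfl fun k _ => ?_
    simp only [g, Set.indicator, Set.mem_ofPred_eq, Pi.one_apply]
    split_ifs <;> simp
  -- The mean is at most `n / 16`, and `(1/16) / (3/32) = 2/3`.
  have h1 : Q {z | ENNReal.ofReal (3 / 32 * Fintype.card ι) ≤ ∑ k, g (z k)} ≤
      ENNReal.ofReal (2 / 3) := by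
    refine (meas_ge_le_lintegral_div hS.aemeasurable (by simpa using hn)
      ENNReal.ofReal_ne_top).trans ?_
    rw [lintegral_sum_pi P hg, lintegral_indicator_one hm]
    refine ENNReal.div_le_of_le_mul ?_
    rw [← ENNReal.ofReal_mul (by norm_num)]
    calc _ ≤ (Fintype.card ι : ENNReal) * ENNReal.ofReal (1 / 16) := by gcongr
      _ = ENNReal.ofReal (Fintype.card ι * (1 / 16)) := by
        rw [ENNReal.ofReal_mul (by positivity), ENNReal.ofReal_natCast]
      _ ≤ _ := ENNReal.ofReal_le_ofReal (by linarith)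
  have h2 := prob_add_prob_compl (μ := Q) (measurableSet_le (measurable_const
    (a := ENNReal.ofReal (3 / 32 * Fintype.card ι))) hS)
  have h3 : {z : ι → Z | ENNReal.ofReal (3 / 32 * Fintype.card ι) ≤ ∑ k, g (z k)}ᶜ ⊆
      {z | ∑ k, (if f (z k) = true then (1 : ℝ) else 0) ≤ 3 / 32 * Fintype.card ι} := by
    intro z hz
    simp only [Set.mem_compl_iff, Set.mem_ofPred_eq, not_le, e] at hz
    exact ((ENNReal.ofReal_lt_ofReal_iff (by positivity)).1 hz).le
  refine le_trans ?_ (measure_mono h3)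
  have h4 : (1 : ENNReal) = ENNReal.ofReal (2 / 3) + ENNReal.ofReal (1 / 3) := by
    rw [← ENNReal.ofReal_add (by norm_num) (by norm_num)]; norm_num
  rw [h4] at h2
  by_contra hlt
  exact absurd h2 (ENNReal.add_lt_add_of_le_of_lt (by finiteness) h1 (not_le.1 hlt)).ne

/-- A lower bound for the measure of a subset of a product, from its sections over `A`. -/
theorem mul_measure_le_prod {U V : Type*} [MeasurableSpace U] [MeasurableSpace V]
    (μ : Measure U) (ν : Measure V) [SFinite ν] (A : Set U) (D : Set (U × V)) (c : ENNReal)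
    (h : ∀ u ∈ A, c ≤ ν (Prod.mk u ⁻¹' D)) : c * μ A ≤ (μ.prod ν) D := by
  -- `D` need not be measurable, so Fubini is applied to a measurable hull.
  have hm := measurableSet_toMeasurable (μ.prod ν) D
  rw [← measure_toMeasurable D, Measure.prod_apply hm]
  refine le_trans ?_ (mul_meas_ge_le_lintegral (measurable_measure_prodMk_left hm) c)
  gcongr
  exact fun u hu => (h u hu).trans (measure_mono (Set.preimage_mono (subset_toMeasurable _ _)))

/-- If `f` has a sum above `(s + 3/32) n` on the sample, then with probability at least `1/3` its
sum on an independent ghost sample is at most `3/32 n`, so the two differ by more than `s n`. This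
costs the factor 3. The event may be nonmeasurable; its outer measure is bounded. -/
theorem measure_exists_sum_gt_le {Z ι : Type*} [MeasurableSpace Z] [Fintype ι] [Nonempty ι]
    {P : Measure Z} [IsProbabilityMeasure P] {F : Set (Z → Bool)} (hF : IsMeasurableClass P F)
    (hmeas : ∀ f ∈ F, Measurable f) (hP : ∀ f ∈ F, P {y | f y = true} ≤ ENNReal.ofReal (1 / 16))
    {s R : ℝ} (hs : 0 ≤ s) (hR : ∀ w : ι ⊕ ι → Z, ((traceFamily F w).card : ℝ) ≤ R) :
    (Measure.pi fun _ : ι => P) {z | ∃ f ∈ F, (s + 3 / 32) * Fintype.card ι <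
        ∑ k, (if f (z k) = true then (1 : ℝ) else 0)} ≤
      ENNReal.ofReal (3 * (R * (2 * Real.exp (-(Fintype.card ι * (s ^ 2 / 2)))))) := by
  set Q := Measure.pi fun _ : ι => P
  set A := {z : ι → Z | ∃ f ∈ F, (s + 3 / 32) * Fintype.card ι <
        ∑ k, (if f (z k) = true then (1 : ℝ) else 0)}
  set D := {w : ι ⊕ ι → Z | s * Fintype.card ι < supWeightedSum F doubleSign w}
  have h1 := measure_supWeightedSum_le (ι := ι) hF hs hR
  have hψ := measurePreserving_sumPiEquivProdPi_symm (fun _ : ι ⊕ ι => P)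
  have h2 : ENNReal.ofReal (1 / 3) * Q A ≤ (Measure.pi fun _ : ι ⊕ ι => P) D := by
    rw [← hψ.measure_preimage_equiv]
    refine mul_measure_le_prod Q Q A _ _ ?_
    rintro z ⟨f, hf, hz⟩
    refine (third_le_measure_sum_le (ι := ι) P (hmeas f hf) (hP f hf)).trans
      (measure_mono fun z' hz' => ?_)
    refine (lt_supWeightedSum_iff (by positivity)).2 ⟨f, hf, lt_of_lt_of_le ?_ (le_abs_self _)⟩
    rw [Fintype.sum_sum_type]
    simp only [MeasurableEquiv.coe_sumPiEquivProdPi_symm, Equiv.sumPiEquivProdPi_symm_apply,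
      doubleSign, Sum.elim_inl, Sum.elim_inr, one_mul, neg_one_mul, Finset.sum_neg_distrib]
    simp only [Set.mem_ofPred_eq] at hz'
    linarith
  have h3 : Q A = ENNReal.ofReal 3 * (ENNReal.ofReal (1 / 3) * Q A) := by
    rw [← mul_assoc, ← ENNReal.ofReal_mul (by norm_num)]; norm_num
  rw [h3, ENNReal.ofReal_mul (by norm_num)]
  gcongr
  exact h2.trans h1

/-! ### Deviation bounds with explicit constants -/

/-- Chernoff's bound for one function. -/
theorem measure_sum_gt_le {Z ι : Type*} [MeasurableSpace Z] [Fintype ι]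
    {P : Measure Z} [IsProbabilityMeasure P] {f : Z → Bool} (hf : Measurable f)
    (hP : P {y | f y = true} ≤ ENNReal.ofReal (1 / 16)) (t : ℝ) :
    (Measure.pi fun _ : ι => P) {z | t * Fintype.card ι <
        ∑ k, (if f (z k) = true then (1 : ℝ) else 0)} ≤
      ENNReal.ofReal (Real.exp (Fintype.card ι * (1 / 8 - t))) := by
  set Q := Measure.pi fun _ : ι => P
  set n := (Fintype.card ι : ℝ)
  have hm : MeasurableSet {y | f y = true} := hf (measurableSet_singleton true)
  let g : Z → ℝ := fun y => Real.exp (if f y = true then 1 else 0)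
  have hg : g = fun y => 1 + (Real.exp 1 - 1) * {y | f y = true}.indicator 1 y := by
    funext y
    simp only [g, Set.indicator, Set.mem_ofPred_eq, Pi.one_apply]
    split_ifs <;> simp
  have hi : Integrable ({y | f y = true}.indicator (1 : Z → ℝ)) P :=
    (integrable_const (1 : ℝ)).indicator hm
  have hgi : Integrable g P := by
    rw [hg]; exact (integrable_const _).add (hi.const_mul _)
  have hPr : P.real {y | f y = true} ≤ 1 / 16 := ENNReal.toReal_le_of_le_ofReal (by norm_num) hP
  have hint : ∫ y, g y ∂P ≤ Real.exp (1 / 8) := by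
    rw [hg, integral_add (integrable_const _) (hi.const_mul _), integral_const_mul,
      integral_indicator_one hm]
    -- `1 + (e - 1) / 16 ≤ 1 + 1/8 ≤ exp (1/8)`, because `e < 3`.
    have h1 := Real.exp_one_lt_d9
    have h2 := Real.add_one_le_exp (1 / 8 : ℝ)
    have h3 := Real.add_one_le_exp (1 : ℝ)
    simp only [integral_const, probReal_univ, smul_eq_mul, mul_one]
    nlinarith
  have hprod : ∀ z : ι → Z, Real.exp (∑ k, (if f (z k) = true then (1 : ℝ) else 0)) =
      ∏ k, g (z k) := fun z => Real.exp_sum _ _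
  have hI : Integrable (fun z : ι → Z => ∏ k, g (z k)) Q :=
    Integrable.fintype_prod fun _ => hgi
  have hmarkov := mul_meas_ge_le_integral_of_nonneg (μ := Q)
    (Filter.Eventually.of_forall fun z => Finset.prod_nonneg fun k _ => (Real.exp_pos _).le)
    hI (Real.exp (t * n))
  have hpw : ∫ z, ∏ k, g (z k) ∂Q = (∫ y, g y ∂P) ^ Fintype.card ι :=
    integral_fintype_prod_eq_pow g
  have hpow : (∫ y, g y ∂P) ^ Fintype.card ι ≤ Real.exp (n * (1 / 8)) := by
    rw [Real.exp_nat_mul]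
    exact pow_le_pow_left₀ (integral_nonneg fun _ => (Real.exp_pos _).le) hint _
  have hreal : Q.real {z | Real.exp (t * n) ≤ ∏ k, g (z k)} ≤ Real.exp (n * (1 / 8 - t)) := by
    refine le_of_mul_le_mul_left ?_ (Real.exp_pos (t * n))
    rw [← Real.exp_add]
    refine (hmarkov.trans (hpw.trans_le hpow)).trans (Real.exp_le_exp.2 (by linarith))
  refine (measure_mono fun z hz => ?_).trans
    ((ENNReal.le_ofReal_iff_toReal_le (measure_ne_top _ _) (Real.exp_pos _).le).2 hreal)
  simp only [Set.mem_ofPred_eq] at hz ⊢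
  rw [← hprod]
  exact Real.exp_le_exp.2 hz.le

/-- The uniform deviation bound with explicit constants. -/
theorem measure_exists_sum_gt_le_exp {Z ι : Type*} [MeasurableSpace Z] [Fintype ι] [Nonempty ι]
    {P : Measure Z} [IsProbabilityMeasure P] {F : Set (Z → Bool)} (hF : IsMeasurableClass P F)
    (hmeas : ∀ f ∈ F, Measurable f) (hP : ∀ f ∈ F, P {y | f y = true} ≤ ENNReal.ofReal (1 / 16))
    {d : ℕ} (hd : vcDimension F ≤ d) (hK : 2 ^ 17 * d ≤ Fintype.card ι) :
    (Measure.pi fun _ : ι => P) {z | ∃ f ∈ F, (1 / 4 - 1 / 2 ^ 17) * Fintype.card ι <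
        ∑ k, (if f (z k) = true then (1 : ℝ) else 0)} ≤
      ENNReal.ofReal (Real.exp (-(Fintype.card ι : ℝ) / 128)) := by
  set n := (Fintype.card ι : ℝ) with hn
  have hn0 : 0 ≤ n := Nat.cast_nonneg _
  -- For `d = 0` the hypothesis `hK` is void and cannot absorb the prefactor 6 of the union bound;
  -- but the class then has at most one member, and Chernoff's bound has no prefactor.
  rcases Nat.eq_zero_or_pos d with rfl | hd0
  · rcases F.eq_empty_or_nonempty with rfl | ⟨f, hf⟩
    · simp
    · have hs := subsingleton_of_vcDimension_le_zero hd
      refine (measure_mono ?_).trans ((measure_sum_gt_le (ι := ι) (hmeas f hf) (hP f hf)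
        (1 / 4 - 1 / 2 ^ 17)).trans (ENNReal.ofReal_le_ofReal (Real.exp_le_exp.2 ?_)))
      · rintro z ⟨f', hf', hz⟩
        rwa [hs hf' hf] at hz
      · rw [← hn]; linarith
  · have hKn : (2 : ℝ) ^ 17 * d ≤ n := by rw [hn]; exact_mod_cast hK
    have hd1 : (1 : ℝ) ≤ d := by exact_mod_cast hd0
    have hR : ∀ w : ι ⊕ ι → Z, ((traceFamily F w).card : ℝ) ≤
        Real.exp (1 / 2048 * (2 * n)) * Real.exp (11 * d) := by
      intro w
      have h1 : ((traceFamily F w).card : ℝ) ≤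
          ∑ k ∈ Finset.Iic d, ((Fintype.card (ι ⊕ ι)).choose k : ℝ) := by
        exact_mod_cast card_traceFamily_le hd w
      have h2 := sum_choose_le (n := Fintype.card (ι ⊕ ι)) (d := d) (x := 1 / 2048)
        (by norm_num) (by norm_num)
      have h3 : ((Fintype.card (ι ⊕ ι) : ℕ) : ℝ) = 2 * n := by
        rw [Fintype.card_sum, hn]; push_cast; ring
      rw [h3] at h2
      refine h1.trans (h2.trans ?_)
      gcongr
      have h4 : (1 / 2048 : ℝ)⁻¹ ≤ Real.exp 11 := by
        have h5 : (2 : ℝ) ≤ Real.exp 1 := by linarith [Real.add_one_le_exp (1 : ℝ)]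
        have h6 : Real.exp 11 = Real.exp 1 ^ 11 := by rw [← Real.exp_nat_mul]; norm_num
        rw [h6]
        calc (1 / 2048 : ℝ)⁻¹ = 2 ^ 11 := by norm_num
          _ ≤ _ := by gcongr
      calc _ ≤ Real.exp 11 ^ d := by gcongr
        _ = _ := by rw [← Real.exp_nat_mul, mul_comm]
    -- This `s` makes the threshold exactly `1/4 - 2⁻¹⁷`. The rate `s² / 2`, about `25/2048`,
    -- exceeds `1/1024 + 1/128` by about `7/2048`, which covers `5 + 11 d ≤ 16 d ≤ n / 8192`.
    have h := measure_exists_sum_gt_le (ι := ι) hF hmeas hP (s := 5 / 32 - 1 / 2 ^ 17)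
      (by norm_num) hR
    rw [show (5 / 32 - 1 / 2 ^ 17 + 3 / 32 : ℝ) = 1 / 4 - 1 / 2 ^ 17 by norm_num] at h
    refine h.trans (ENNReal.ofReal_le_ofReal ?_)
    have h6 : (6 : ℝ) ≤ Real.exp 5 := by linarith [Real.add_one_le_exp (5 : ℝ)]
    calc _ = 6 * (Real.exp (1 / 2048 * (2 * n)) * Real.exp (11 * d) *
          Real.exp (-(n * ((5 / 32 - 1 / 2 ^ 17) ^ 2 / 2)))) := by rw [← hn]; ring
      _ ≤ Real.exp 5 * (Real.exp (1 / 2048 * (2 * n)) * Real.exp (11 * d) *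
          Real.exp (-(n * ((5 / 32 - 1 / 2 ^ 17) ^ 2 / 2)))) := by gcongr
      _ = Real.exp (5 + (1 / 2048 * (2 * n) + 11 * d +
          -(n * ((5 / 32 - 1 / 2 ^ 17) ^ 2 / 2)))) := by simp only [Real.exp_add]
      _ ≤ _ := Real.exp_le_exp.2 (by linarith)

/-! ### Law of the blocks -/

/-- For disjoint blocks drawn independently of an i.i.d. sample, the blocks of data are i.i.d. -/
theorem map_dataBlock_eq_pi {Ω α : Type*} [MeasurableSpace Ω] [MeasurableSpace α]
    {μ : Measure Ω} [IsProbabilityMeasure μ] {N K m : ℕ} (k₀ : Fin K)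
    {Y : Fin N → Ω → α} (hY : ∀ i, Measurable (Y i)) (hind : iIndepFun Y μ)
    (hid : ∀ i j, IdentDistrib (Y i) (Y j) μ μ)
    {B : Ω → Fin K → Fin m → Fin N} (hB : Measurable B)
    (hinj : ∀ ω, Function.Injective fun p : Fin K × Fin m => B ω p.1 p.2)
    (hBY : IndepFun B (fun ω i => Y i ω) μ) :
    μ.map (fun ω => dataBlock (B ω) fun i => Y i ω) =
      Measure.pi fun _ => μ.map fun ω => dataBlock (B ω) (fun i => Y i ω) k₀ := by
  have hYm : Measurable fun ω i => Y i ω := measurable_pi_lambda _ hY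
  have hprob : ∀ i, IsProbabilityMeasure (μ.map (Y i)) := fun i =>
    Measure.isProbabilityMeasure_map (hY i).aemeasurable
  have hblock : ∀ b : Fin K → Fin m → Fin N,
      Measurable fun y : Fin N → α => dataBlock b y := fun b =>
    measurable_pi_lambda _ fun k => measurable_pi_lambda _ fun j => measurable_pi_apply (b k j)
  obtain ⟨ω₀⟩ : Nonempty Ω := nonempty_of_isProbabilityMeasure μ
  let R : Measure (Fin m → α) := Measure.pi fun j => μ.map (Y (B ω₀ k₀ j))
  -- For a fixed `b`, injectivity makes the selected variables independent, and identical
  -- distribution makes the block law equal to `R` whatever `b` is.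
  have hfix : ∀ b : Fin K → Fin m → Fin N,
      (Function.Injective fun p : Fin K × Fin m => b p.1 p.2) →
      (μ.map fun ω i => Y i ω).map (dataBlock b) = Measure.pi fun _ => R := by
    intro b hb
    have h1 := (hind.precomp hb).map_fun_eq_pi_map fun p => (hY _).aemeasurable
    have h2 := Measure.infinitePi_map_curry fun k j => μ.map (Y (b k j))
    simp only [Measure.infinitePi_eq_pi] at h2
    rw [Measure.map_map (hblock b) hYm]
    have h3 : (fun _ : Fin K => R) = fun k => Measure.pi fun j => μ.map (Y (b k j)) := by
      funext k
      exact congrArg Measure.pi (funext fun j => (hid _ _).map_eq)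
    rw [h3, ← h2, ← h1, Measure.map_map (by fun_prop)
      (measurable_pi_lambda _ fun p => hY _)]
    rfl
  have hg : Measurable fun q : (Fin K → Fin m → Fin N) × (Fin N → α) => dataBlock q.1 q.2 :=
    measurable_from_prod_countable_right hblock
  have hZ : Measurable fun ω => dataBlock (B ω) fun i => Y i ω :=
    hg.comp (hB.prodMk hYm)
  have hlaw : μ.map (fun ω => dataBlock (B ω) fun i => Y i ω) = Measure.pi fun _ => R := by
    have h1 : (μ.map fun ω => (B ω, fun i => Y i ω)).map (fun q => dataBlock q.1 q.2) =
        μ.map (fun ω => dataBlock (B ω) fun i => Y i ω) :=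
      Measure.map_map hg (hB.prodMk hYm)
    have : IsProbabilityMeasure (μ.map B) := Measure.isProbabilityMeasure_map hB.aemeasurable
    rw [← h1, hBY.map_prod_eq_prod_map_map hB.aemeasurable hYm.aemeasurable]
    ext S hS
    rw [Measure.map_apply hg hS, Measure.prod_apply (hg hS)]
    -- Independence of `B` and the sample allows freezing `B = b`; the section measure is then
    -- constant in `b`.
    have h2 : ∀ᵐ b ∂(μ.map B), (μ.map fun ω i => Y i ω)
        (Prod.mk b ⁻¹' ((fun q : (Fin K → Fin m → Fin N) × (Fin N → α) =>
          dataBlock q.1 q.2) ⁻¹' S)) = (Measure.pi fun _ => R) S := by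
      refine (ae_map_iff hB.aemeasurable (Set.to_countable _).measurableSet).2
        (Filter.Eventually.of_forall fun ω => ?_)
      rw [← hfix (B ω) (hinj ω), Measure.map_apply (hblock _) hS]
      rfl
    rw [lintegral_congr_ae h2]
    simp
  have hR : μ.map (fun ω => dataBlock (B ω) (fun i => Y i ω) k₀) = R := by
    rw [← (measurePreserving_eval (fun _ : Fin K => R) k₀).map_eq, ← hlaw,
      Measure.map_map (measurable_pi_apply k₀) hZ]
    rfl
  rw [hlaw, hR]

/-! ### Outliers and conclusion -/

/-- With disjoint blocks, at most `O.card` blocks meet `O`. -/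
theorem card_blocks_meeting_le {N K m : ℕ} {b : Fin K → Fin m → Fin N}
    (hb : Function.Injective fun p : Fin K × Fin m => b p.1 p.2) (O : Finset (Fin N)) :
    (Finset.univ.filter fun k => ∃ j, b k j ∈ O).card ≤ O.card := by
  classical
  rcases isEmpty_or_nonempty (Fin m) with hm | hm
  · simp
  -- Picking one outlier in each contaminated block is injective by disjointness.
  choose! j hj using fun (k : Fin K) (h : ∃ j, b k j ∈ O) => h
  refine Finset.card_le_card_of_injOn (fun k => b k (j k)) ?_ ?_
  · intro k hk
    exact hj k (Finset.mem_filter.1 hk).2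
  · intro k _ k' _ h
    exact congrArg Prod.fst (@hb (k, j k) (k', j k') h)

/-- A block with `f = 1` on the corrupted data either has `f = 1` on the clean data or meets `O`.
The two counts are at most `(1/4 - 2⁻¹⁷) K` and `2⁻¹⁷ K`. -/
theorem card_false_ge {α : Type*} {N K m : ℕ} {b : Fin K → Fin m → Fin N}
    (hb : Function.Injective fun p : Fin K × Fin m => b p.1 p.2) {O : Finset (Fin N)}
    {x y : Fin N → α} (hxy : ∀ i, i ∉ O → x i = y i) (hO : 2 ^ 17 * O.card ≤ K)
    {f : (Fin m → α) → Bool}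
    (hf : ∑ k, (if f (dataBlock b y k) = true then (1 : ℝ) else 0) ≤ (1 / 4 - 1 / 2 ^ 17) * K) :
    3 * (K : ℝ) / 4 ≤
      ((Finset.univ.filter fun k : Fin K => f (dataBlock b x k) = false).card : ℝ) := by
  classical
  have hsub : (Finset.univ : Finset (Fin K)) ⊆
      (Finset.univ.filter fun k : Fin K => f (dataBlock b x k) = false) ∪
      ((Finset.univ.filter fun k : Fin K => f (dataBlock b y k) = true) ∪
        Finset.univ.filter fun k => ∃ j, b k j ∈ O) := by
    intro k _
    by_cases hk : ∃ j, b k j ∈ O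
    · simp [hk]
    · have : dataBlock b x k = dataBlock b y k := by
        funext j; exact hxy _ fun h => hk ⟨j, h⟩
      cases h : f (dataBlock b y k) <;> simp [this, h]
  have h1 := (Finset.card_le_card hsub).trans
    ((Finset.card_union_le _ _).trans (Nat.add_le_add_left (Finset.card_union_le _ _) _))
  rw [Finset.card_univ, Fintype.card_fin] at h1
  have h2 := card_blocks_meeting_le hb O
  rw [Finset.sum_boole] at hf
  have h1' := (Nat.cast_le (α := ℝ)).2 h1
  have h2' : ((Finset.univ.filter fun k => ∃ j, b k j ∈ O).card : ℝ) ≤ O.card := by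
    exact_mod_cast h2
  have hO' : (2 : ℝ) ^ 17 * O.card ≤ K := by exact_mod_cast hO
  push_cast at h1'
  linarith

theorem lemma2 :
    ∃ C : ℕ, 0 < C ∧
      ∀ {Ω : Type*} [MeasurableSpace Ω] (μ : Measure Ω) [IsProbabilityMeasure μ]
        {α : Type*} [MeasurableSpace α] (N K m : ℕ) (hK : 0 < K)
        -- the uncorrupted i.i.d. sample
        (Y : Fin N → Ω → α) (_ : ∀ i, Measurable (Y i)) (_ : iIndepFun Y μ)
        (_ : ∀ i j, IdentDistrib (Y i) (Y j) μ μ)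
        -- the observed sample and the random set of outliers
        (X : Fin N → Ω → α) (O : Ω → Finset (Fin N))
        (_ : ∀ᵐ ω ∂μ, ∀ i, i ∉ O ω → X i ω = Y i ω)
        -- the (possibly random) splitting into `K` disjoint blocks of size `m`
        (B : Ω → Fin K → Fin m → Fin N) (_ : Measurable B)
        (_ : ∀ ω, Function.Injective fun p : Fin K × Fin m => B ω p.1 p.2)
        (_ : IndepFun B (fun ω i => Y i ω) μ)
        -- the class of Boolean functions on blocks
        (F : Set ((Fin m → α) → Bool)) (_ : ∀ f ∈ F, Measurable f)
        (_ : IsMeasurableClass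
          (μ.map fun ω => dataBlock (B ω) (fun i => Y i ω) ⟨0, hK⟩) F)
        (_ : ∀ f ∈ F,
          15 / 16 ≤ μ.real {ω | f (dataBlock (B ω) (fun i => Y i ω) ⟨0, hK⟩) = false})
        (_ : ∀ᵐ ω ∂μ, (C : ℕ∞) * max (vcDimension F) ((O ω).card : ℕ∞) ≤ (K : ℕ∞)),
        ∃ E : Set Ω, MeasurableSet E ∧ 1 - Real.exp (-(K : ℝ) / 128) ≤ μ.real E ∧
          ∀ ω ∈ E, ∀ f ∈ F,
            3 * (K : ℝ) / 4 ≤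
              ((Finset.univ.filter fun k : Fin K =>
                f (dataBlock (B ω) (fun i => X i ω) k) = false).card : ℝ) := by
  refine ⟨2 ^ 17, by norm_num, ?_⟩
  intro Ω _ μ _ α _ N K m hK Y hY hind hid X O hXY B hB hinj hBY F hmeas hF hP hKC
  set P := μ.map fun ω => dataBlock (B ω) (fun i => Y i ω) ⟨0, hK⟩ with hPdef
  have : Nonempty (Fin K) := ⟨⟨0, hK⟩⟩
  have hZ : Measurable fun ω => dataBlock (B ω) fun i => Y i ω :=
    (measurable_from_prod_countable_right fun b => measurable_pi_lambda _ fun k =>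
      measurable_pi_lambda _ fun j => measurable_pi_apply (b k j) :
      Measurable fun q : (Fin K → Fin m → Fin N) × (Fin N → α) => dataBlock q.1 q.2).comp
      (hB.prodMk (measurable_pi_lambda _ hY))
  have hZ0 : Measurable fun ω => dataBlock (B ω) (fun i => Y i ω) ⟨0, hK⟩ :=
    (measurable_pi_apply _).comp hZ
  have : IsProbabilityMeasure P := Measure.isProbabilityMeasure_map hZ0.aemeasurable
  have hlaw := map_dataBlock_eq_pi ⟨0, hK⟩ hY hind hid hB hinj hBY
  have hKC' : ∀ᵐ ω ∂μ, vcDimension F ≠ ⊤ ∧ 2 ^ 17 * (vcDimension F).toNat ≤ K ∧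
      2 ^ 17 * (O ω).card ≤ K := by
    filter_upwards [hKC] with ω h
    have h1 : ((2 ^ 17 : ℕ) : ℕ∞) * vcDimension F ≤ K := le_trans (by gcongr; simp) h
    have h2 : ((2 ^ 17 : ℕ) : ℕ∞) * (O ω).card ≤ K := le_trans (by gcongr; simp) h
    have h3 : vcDimension F ≠ ⊤ := by
      intro htop
      rw [htop, ENat.mul_top (by norm_num)] at h1
      exact absurd h1 (by simp)
    refine ⟨h3, ?_, by exact_mod_cast h2⟩
    rw [← ENat.natCast_toNat h3] at h1
    exact_mod_cast h1
  -- The VC dimension is deterministic, so a single `ω₀` yields its finiteness and its bound.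
  obtain ⟨ω₀, hd, hdK, -⟩ := hKC'.exists
  have hP' : ∀ f ∈ F, P {y | f y = true} ≤ ENNReal.ofReal (1 / 16) := by
    intro f hf
    have hm : MeasurableSet {y | f y = true} := hmeas f hf (measurableSet_singleton true)
    have h1 := hP f hf
    have h2 : {ω | f (dataBlock (B ω) (fun i => Y i ω) ⟨0, hK⟩) = false} =
        ((fun ω => dataBlock (B ω) (fun i => Y i ω) ⟨0, hK⟩) ⁻¹' {y | f y = true})ᶜ := by
      ext ω; simp
    rw [h2, probReal_compl_eq_one_sub (hZ0 hm)] at h1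
    rw [hPdef, Measure.map_apply hZ0 hm,
      ENNReal.le_ofReal_iff_toReal_le (measure_ne_top _ _) (by norm_num)]
    change μ.real _ ≤ _
    linarith
  have hdev := measure_exists_sum_gt_le_exp (ι := Fin K) hF hmeas hP'
    (ENat.natCast_toNat hd).ge (by simpa using hdK)
  rw [← hlaw, Fintype.card_fin] at hdev
  set A := {z : Fin K → Fin m → α | ∃ f ∈ F, (1 / 4 - 1 / 2 ^ 17) * (K : ℝ) <
    ∑ k, (if f (z k) = true then (1 : ℝ) else 0)}
  set Q := μ.map fun ω => dataBlock (B ω) fun i => Y i ω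
  -- `A` may be nonmeasurable; its hull has the same measure and gives a measurable event.
  let bad := toMeasurable Q A
  obtain ⟨G, hG, hGm, hGsub⟩ := (hXY.and hKC').exists_measurable_mem
  have hE : MeasurableSet (((fun ω => dataBlock (B ω) fun i => Y i ω) ⁻¹' bad)ᶜ ∩ G) :=
    (hZ (measurableSet_toMeasurable _ _)).compl.inter hGm
  refine ⟨_, hE, ?_, ?_⟩
  · have h1 : μ (((fun ω => dataBlock (B ω) fun i => Y i ω) ⁻¹' bad)ᶜ ∩ G)ᶜ ≤
        ENNReal.ofReal (Real.exp (-(K : ℝ) / 128)) := by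
      rw [Set.compl_inter, compl_compl]
      refine (measure_union_le _ _).trans ?_
      rw [mem_ae_iff.1 hG, add_zero, ← Measure.map_apply hZ (measurableSet_toMeasurable _ _),
        measure_toMeasurable]
      exact hdev
    have h2 := ENNReal.toReal_le_of_le_ofReal (Real.exp_pos _).le h1
    change μ.real _ ≤ _ at h2
    rw [probReal_compl_eq_one_sub hE] at h2
    linarith
  · rintro ω ⟨hω, hωG⟩ f hf
    obtain ⟨h1, -, -, h2⟩ := hGsub ω hωG
    refine card_false_ge (hinj ω) h1 h2 (not_lt.1 fun h => hω ?_)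
    exact subset_toMeasurable Q A ⟨f, hf, h⟩
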